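/- **Formulas.** Fix a first-order vocabulary $\tau$ (relation and function symbols with arities, constants) and variables $x_0,x_1,\dots$. *Classical* (first-order) formulas are built from atoms $t_1=t_2$ and $R(t_1,\dots,t_n)$ with $\neg$, $\to$ and $\forall x$; $\alpha,\beta,\gamma$ denote classical formulas and $\alpha\lor\beta:=\neg\alpha\to\beta$. $\mathcal Q(\mathrm{FO})$ is the closure of the classical formulas under strong negation ${\sim}\varphi$, material implication $\varphi\rightarrowtriangle\psi$, linear implication $\varphi\multimap\psi$, and the team quantifiers $\forall x\,\varphi$ and $!x\,\varphi$ ("shriek"); on classical formulas the team quantifier $\forall x$ is the first-order quantifier, so that $\forall x\,\alpha$ is again classical. $\mathcal B(\mathrm{FO})\subseteq\mathcal Q(\mathrm{FO})$ is the closure of the classical formulas under ${\sim}$ and $\rightarrowtriangle$ only. Abbreviate $\varphi\otimes\psi:={\sim}(\varphi\multimap{\sim}\psi)$, $\exists x\,\varphi:={\sim}\,!x\,{\sim}\varphi$, and $\varphi\leftrightarrowtriangle\psi:={\sim}\big((\varphi\rightarrowtriangle\psi)\rightarrowtriangle{\sim}(\psi\rightarrowtriangle\varphi)\big)$. All implications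 associate to the right. **The proof system $\mathsf{HLSQ}$** on $\mathcal Q(\mathrm{FO})$ is the union of the following four systems, where $\varphi,\psi,\vartheta$ range over all $\mathcal Q(\mathrm{FO})$ formulas. A rule marked (thm) may only be applied to a theorem, i.e. to a formula derived without premises. * $\mathsf H$: $\alpha\to(\beta\to\alpha)$; $(\alpha\to(\beta\to\gamma))\to(\alpha\to\beta)\to(\alpha\to\gamma)$; $(\neg\alpha\to\neg\beta)\to(\beta\to\alpha)$; $\forall x\,\alpha\to\alpha[x/t]$ for a term $t$ that is free for $x$ in $\alpha$; $\forall x(\alpha\to\beta)\to(\alpha\to\forall x\,\beta)$ if $x$ is not free in $\alpha$; $x=x$; $x=y\to(\alpha\to\alpha[x/y])$ if $y$ is free for $x$ in $\alpha$. Rules: from $\alpha$ and $\alpha\to\beta$ infer $\beta$; from $\alpha$ infer $\forall x\,\alpha$ (thm). * $\mathsf L$: $\varphi\rightarrowtriangle(\psi\rightarrowtriangle\varphi)$; $(\varphi\rightarrowtriangle(\psi\rightarrowtriangle\vartheta))\rightarrowtriangle(\varphi\rightarrowtriangle\psi)\rightarrowtriangle(\varphi\rightarrowtriangle\vartheta)$;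 $({\sim}\varphi\rightarrowtriangle{\sim}\psi)\rightarrowtriangle(\psi\rightarrowtriangle\varphi)$; $(\alpha\to\beta)\rightarrowtriangle(\alpha\rightarrowtriangle\beta)$. Rule: from $\varphi$ and $\varphi\rightarrowtriangle\psi$ infer $\psi$. * $\mathsf S$: $(\alpha\otimes\beta)\leftrightarrowtriangle(\alpha\lor\beta)$; $\alpha\rightarrowtriangle(\varphi\multimap\alpha)$; $\varphi\rightarrowtriangle(\varphi\multimap\psi)\rightarrowtriangle(\vartheta\multimap\psi)$; $(\varphi\multimap\psi\multimap\vartheta)\rightarrowtriangle(\psi\multimap\varphi\multimap\vartheta)$; $(\varphi\multimap{\sim}\psi)\rightarrowtriangle(\psi\multimap{\sim}\varphi)$; $(\varphi\multimap(\psi\rightarrowtriangle\vartheta))\rightarrowtriangle(\varphi\multimap\psi)\rightarrowtriangle(\varphi\multimap\vartheta)$. Rule: from $\varphi$ infer $\psi\multimap\varphi$ (thm). * $\mathsf Q$: $\forall x\,{\sim}\varphi\leftrightarrowtriangle{\sim}\forall x\,\varphi$; $\exists x\,\alpha\leftrightarrowtriangle\neg\forall x\,\neg\alpha$; $\exists x(\varphi\otimes\psi)\leftrightarrowtriangle(\exists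 x\,\varphi\otimes\exists x\,\psi)$; $\forall x\,\alpha\rightarrowtriangle\,!x\,\alpha$; $!x\,\psi\rightarrowtriangle\forall x\,\psi$; $\forall x(\varphi\rightarrowtriangle\psi)\rightarrowtriangle(\forall x\,\varphi\rightarrowtriangle\forall x\,\psi)$; $!x(\varphi\rightarrowtriangle\psi)\rightarrowtriangle(!x\,\varphi\rightarrowtriangle\,!x\,\psi)$. Rule: from $\varphi$ infer $!x\,\varphi$ (thm). **Theorem.** For every $\mathcal Q(\mathrm{FO})$ formula $\varphi$ there is a $\mathcal B(\mathrm{FO})$ formula $\varphi'$ that is provably equivalent to $\varphi$ in $\mathsf{HLSQ}$, i.e. $\{\varphi\}\vdash_{\mathsf{HLSQ}}\varphi'$ and $\{\varphi'\}\vdash_{\mathsf{HLSQ}}\varphi$. -/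

import Mathlib

namespace TeamLogic

universe u v

/-- The two kinds of formulas: `classical` ones (first-order formulas) and proper `team` formulas
(those in which a team connective occurs). -/
inductive Kind
  | classical
  | team

/-- Formulas of quantified team logic over first-order logic, with variables `0, 1, 2, …`, indexed
by their kind. Terms are Mathlib's terms over the vocabulary `L` (constants are `0`-ary function
symbols). Classical negation and implication only apply to classical formulas. There is a single
universal quantifier: applied to a classical formula it gives a classical formula. -/
inductive Fm (L : FirstOrder.Language.{u, v}) : Kind → Type (max u v)
  /-- `t = u` -/
  | equal (t u : L.Term ℕ) : Fm L .classical
  /-- `R(t₁, …, tₙ)` -/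
  | rel {n : ℕ} (R : L.Relations n) (ts : Fin n → L.Term ℕ) : Fm L .classical
  /-- classical negation `¬α` -/
  | neg (α : Fm L .classical) : Fm L .classical
  /-- classical implication `α → β` -/
  | imp (α β : Fm L .classical) : Fm L .classical
  /-- `∀ x φ` -/
  | all {k : Kind} (x : ℕ) (φ : Fm L k) : Fm L k
  /-- strong negation `~φ` -/
  | snot {k : Kind} (φ : Fm L k) : Fm L .team
  /-- material implication -/
  | mimp {k l : Kind} (φ : Fm L k) (ψ : Fm L l) : Fm L .team
  /-- linear implication -/
  | limp {k l : Kind} (φ : Fm L k) (ψ : Fm L l) : Fm L .team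
  /-- the team quantifier `! x φ` (shriek) -/
  | shriek {k : Kind} (x : ℕ) (φ : Fm L k) : Fm L .team

variable {L : FirstOrder.Language.{u, v}}

namespace Fm

/-- The variable `x` occurs freely in the formula. -/
def FreeIn (x : ℕ) : {k : Kind} → Fm L k → Prop
  | _, equal t u => x ∈ t.varFinset ∨ x ∈ u.varFinset
  | _, rel _ ts => ∃ i, x ∈ (ts i).varFinset
  | _, neg α => FreeIn x α
  | _, imp α β => FreeIn x α ∨ FreeIn x β
  | _, all y φ => x ≠ y ∧ FreeIn x φ
  | _, snot φ => FreeIn x φ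
  | _, mimp φ ψ => FreeIn x φ ∨ FreeIn x ψ
  | _, limp φ ψ => FreeIn x φ ∨ FreeIn x ψ
  | _, shriek y φ => x ≠ y ∧ FreeIn x φ

/-- The term `t` is free for `x` in the formula: no variable of `t` is captured when `t` is
substituted for the free occurrences of `x`. -/
def FreeFor (t : L.Term ℕ) (x : ℕ) : {k : Kind} → Fm L k → Prop
  | _, equal _ _ => True
  | _, rel _ _ => True
  | _, neg α => FreeFor t x α
  | _, imp α β => FreeFor t x α ∧ FreeFor t x β
  | _, all y φ => ¬ (x ≠ y ∧ FreeIn x φ) ∨ (y ∉ t.varFinset ∧ FreeFor t x φ)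
  | _, snot φ => FreeFor t x φ
  | _, mimp φ ψ => FreeFor t x φ ∧ FreeFor t x ψ
  | _, limp φ ψ => FreeFor t x φ ∧ FreeFor t x ψ
  | _, shriek y φ => ¬ (x ≠ y ∧ FreeIn x φ) ∨ (y ∉ t.varFinset ∧ FreeFor t x φ)

/-- Substitution of the term `s` for the variable `x` in a term. -/
def substTerm (x : ℕ) (s t : L.Term ℕ) : L.Term ℕ :=
  t.subst (Function.update FirstOrder.Language.Term.var x s)

/-- `φ[x/s]`: substitution of the term `s` for the free occurrences of `x` in a formula. -/
def subst (x : ℕ) (s : L.Term ℕ) : {k : Kind} → Fm L k → Fm L k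
  | _, equal t u => equal (substTerm x s t) (substTerm x s u)
  | _, rel R ts => rel R (fun i => substTerm x s (ts i))
  | _, neg α => neg (subst x s α)
  | _, imp α β => imp (subst x s α) (subst x s β)
  | _, all y φ => if y = x then all y φ else all y (subst x s φ)
  | _, snot φ => snot (subst x s φ)
  | _, mimp φ ψ => mimp (subst x s φ) (subst x s ψ)
  | _, limp φ ψ => limp (subst x s φ) (subst x s ψ)
  | _, shriek y φ => if y = x then shriek y φ else shriek y (subst x s φ)

end Fm

/-- The formulas of first-order logic. -/
abbrev FO (L : FirstOrder.Language.{u, v}) := Fm L .classical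

/-- The formulas of quantified team logic `Q(FO)`. -/
abbrev QFO (L : FirstOrder.Language.{u, v}) := Σ k : Kind, Fm L k

/-- A first-order formula, regarded as a `Q(FO)` formula. -/
def FO.toQFO (α : FO L) : QFO L := ⟨.classical, α⟩

/-- Classical disjunction `α ∨ β`, an abbreviation for `¬α → β`. -/
def FO.disj (α β : FO L) : FO L := .imp (.neg α) β

namespace QFO

def all (x : ℕ) (φ : QFO L) : QFO L := ⟨φ.1, .all x φ.2⟩

def shriek (x : ℕ) (φ : QFO L) : QFO L := ⟨.team, .shriek x φ.2⟩

def snot (φ : QFO L) : QFO L := ⟨.team, .snot φ.2⟩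

def mimp (φ ψ : QFO L) : QFO L := ⟨.team, .mimp φ.2 ψ.2⟩

def limp (φ ψ : QFO L) : QFO L := ⟨.team, .limp φ.2 ψ.2⟩

end QFO

prefix:max "∼ₜ" => QFO.snot
infixr:35 " ▷ " => QFO.mimp
infixr:45 " ⊸ " => QFO.limp

namespace QFO

/-- Strong conjunction. -/
def sand (φ ψ : QFO L) : QFO L := ∼ₜ(φ ▷ ∼ₜψ)

/-- Material equivalence. -/
def miff (φ ψ : QFO L) : QFO L := sand (φ ▷ ψ) (ψ ▷ φ)

/-- Splitting disjunction (tensor). -/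
def tensor (φ ψ : QFO L) : QFO L := ∼ₜ(φ ⊸ ∼ₜψ)

/-- The team quantifier `∃ x φ`. -/
def ex (x : ℕ) (φ : QFO L) : QFO L := ∼ₜ(shriek x ∼ₜφ)

end QFO

infix:30 " ◁▷ " => QFO.miff
infixl:50 " ⊗ᵗ " => QFO.tensor

/-- `B(FO)`: the closure of first-order logic under strong negation and material implication. -/
inductive IsBFO : QFO L → Prop
  | fo (α : FO L) : IsBFO α.toQFO
  | snot {φ : QFO L} : IsBFO φ → IsBFO ∼ₜφ
  | mimp {φ ψ : QFO L} : IsBFO φ → IsBFO ψ → IsBFO (φ ▷ ψ)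

/-- A Hilbert-style proof system on a set `Ξ` of formulas: a set of axioms, a set of inference
rules (a finite list of premises and a conclusion), and a set of inference rules that may only be
applied to theorems. -/
structure ProofSystem (Ξ : Type*) where
  ax : Set Ξ
  rules : Set (List Ξ × Ξ)
  thmRules : Set (List Ξ × Ξ)

namespace ProofSystem

variable {Ξ : Type*}

/-- Component-wise union of proof systems. -/
def union (Ω Ω' : ProofSystem Ξ) : ProofSystem Ξ where
  ax := Ω.ax ∪ Ω'.ax
  rules := Ω.rules ∪ Ω'.rules
  thmRules := Ω.thmRules ∪ Ω'.thmRules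

/-- `Ω.Derives Φ ξ`: the formula `ξ` is derivable in `Ω` from the premises `Φ`. The rules in
`thmRules` are only applied to theorems, that is, to formulas derived without any premises. -/
inductive Derives (Ω : ProofSystem Ξ) : Set Ξ → Ξ → Prop
  | prem {Φ : Set Ξ} {ξ : Ξ} : ξ ∈ Φ → Derives Ω Φ ξ
  | ax {Φ : Set Ξ} {ξ : Ξ} : ξ ∈ Ω.ax → Derives Ω Φ ξ
  | rule {Φ : Set Ξ} {P : List Ξ} {ξ : Ξ} :
      (P, ξ) ∈ Ω.rules → (∀ p ∈ P, Derives Ω Φ p) → Derives Ω Φ ξ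
  | thmRule {Φ : Set Ξ} {P : List Ξ} {ξ : Ξ} :
      (P, ξ) ∈ Ω.thmRules → (∀ p ∈ P, Derives Ω ∅ p) → Derives Ω Φ ξ

/-- Two formulas are provably equivalent if they derive each other. -/
def ProvablyEquivalent (Ω : ProofSystem Ξ) (ξ ξ' : Ξ) : Prop :=
  Ω.Derives {ξ} ξ' ∧ Ω.Derives {ξ'} ξ

end ProofSystem

open FirstOrder.Language.Term (var)

/-- The axioms of classical first-order logic. -/
inductive AxiomH : FO L → Prop
  | A1 (α β : FO L) : AxiomH (.imp α (.imp β α))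
  | A2 (α β γ : FO L) :
      AxiomH (.imp (.imp α (.imp β γ)) (.imp (.imp α β) (.imp α γ)))
  | A3 (α β : FO L) : AxiomH (.imp (.imp (.neg α) (.neg β)) (.imp β α))
  | A4 (x : ℕ) (t : L.Term ℕ) (α : FO L) (h : α.FreeFor t x) :
      AxiomH (.imp (.all x α) (α.subst x t))
  | A5 (x : ℕ) (α β : FO L) (h : ¬ α.FreeIn x) :
      AxiomH (.imp (.all x (.imp α β)) (.imp α (.all x β)))
  | A6 (x : ℕ) : AxiomH (.equal (var x) (var x))
  | A7 (x y : ℕ) (α : FO L) (h : α.FreeFor (var y) x) :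
      AxiomH (.imp (.equal (var x) (var y)) (.imp α (α.subst x (var y))))

/-- The lifted propositional axioms. -/
inductive AxiomL : QFO L → Prop
  | L1 (φ ψ : QFO L) : AxiomL (φ ▷ (ψ ▷ φ))
  | L2 (φ ψ θ : QFO L) : AxiomL ((φ ▷ (ψ ▷ θ)) ▷ ((φ ▷ ψ) ▷ (φ ▷ θ)))
  | L3 (φ ψ : QFO L) : AxiomL ((∼ₜφ ▷ ∼ₜψ) ▷ (ψ ▷ φ))
  | L4 (α β : FO L) :
      AxiomL (FO.toQFO (.imp α β) ▷ (FO.toQFO α ▷ FO.toQFO β))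

/-- The splitting axioms. -/
inductive AxiomS : QFO L → Prop
  | flatTensor (α β : FO L) :
      AxiomS ((FO.toQFO α ⊗ᵗ FO.toQFO β) ◁▷ FO.toQFO (FO.disj α β))
  | flatLimp (φ : QFO L) (α : FO L) : AxiomS (FO.toQFO α ▷ (φ ⊸ FO.toQFO α))
  | lax (φ ψ θ : QFO L) : AxiomS (φ ▷ ((φ ⊸ ψ) ▷ (θ ⊸ ψ)))
  | exchange (φ ψ θ : QFO L) : AxiomS ((φ ⊸ (ψ ⊸ θ)) ▷ (ψ ⊸ (φ ⊸ θ)))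
  | contra (φ ψ : QFO L) : AxiomS ((φ ⊸ ∼ₜψ) ▷ (ψ ⊸ ∼ₜφ))
  | distrib (φ ψ θ : QFO L) :
      AxiomS ((φ ⊸ (ψ ▷ θ)) ▷ ((φ ⊸ ψ) ▷ (φ ⊸ θ)))

/-- The team quantifier axioms. -/
inductive AxiomQ : QFO L → Prop
  | linAll (x : ℕ) (φ : QFO L) : AxiomQ (QFO.all x ∼ₜφ ◁▷ ∼ₜ(QFO.all x φ))
  | flatEx (x : ℕ) (α : FO L) :
      AxiomQ (QFO.ex x α.toQFO ◁▷ FO.toQFO (.neg (.all x (.neg α))))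
  | exTensor (x : ℕ) (φ ψ : QFO L) :
      AxiomQ (QFO.ex x (φ ⊗ᵗ ψ) ◁▷ (QFO.ex x φ ⊗ᵗ QFO.ex x ψ))
  | elimAll (x : ℕ) (α : FO L) :
      AxiomQ (QFO.all x α.toQFO ▷ QFO.shriek x α.toQFO)
  | introAll (x : ℕ) (ψ : QFO L) : AxiomQ (QFO.shriek x ψ ▷ QFO.all x ψ)
  | distribAll (x : ℕ) (φ ψ : QFO L) :
      AxiomQ (QFO.all x (φ ▷ ψ) ▷ (QFO.all x φ ▷ QFO.all x ψ))
  | distribShriek (x : ℕ) (φ ψ : QFO L) :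
      AxiomQ (QFO.shriek x (φ ▷ ψ) ▷ (QFO.shriek x φ ▷ QFO.shriek x ψ))

/-- The system `H` of first-order logic: its axioms, modus ponens for `→`, and generalization of
theorems. -/
def systemH (L : FirstOrder.Language.{u, v}) : ProofSystem (QFO L) where
  ax := {ξ | ∃ α : FO L, AxiomH α ∧ ξ = α.toQFO}
  rules := {r | ∃ α β : FO L, r = ([α.toQFO, FO.toQFO (.imp α β)], β.toQFO)}
  thmRules := {r | ∃ (x : ℕ) (α : FO L), r = ([α.toQFO], FO.toQFO (.all x α))}

/-- The system `L` of lifted propositional axioms, with modus ponens for material implication. -/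
def systemL (L : FirstOrder.Language.{u, v}) : ProofSystem (QFO L) where
  ax := {ξ | AxiomL ξ}
  rules := {r | ∃ φ ψ : QFO L, r = ([φ, φ ▷ ψ], ψ)}
  thmRules := ∅

/-- The system `S` of splitting axioms, with the necessitation rule for linear implication. -/
def systemS (L : FirstOrder.Language.{u, v}) : ProofSystem (QFO L) where
  ax := {ξ | AxiomS ξ}
  rules := ∅
  thmRules := {r | ∃ φ ψ : QFO L, r = ([φ], ψ ⊸ φ)}

/-- The system `Q` of team quantifier axioms, with generalization of theorems for shriek. -/
def systemQ (L : FirstOrder.Language.{u, v}) : ProofSystem (QFO L) where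
  ax := {ξ | AxiomQ ξ}
  rules := ∅
  thmRules := {r | ∃ (x : ℕ) (φ : QFO L), r = ([φ], QFO.shriek x φ)}

/-- The proof system `HLSQ`. -/
def HLSQ (L : FirstOrder.Language.{u, v}) : ProofSystem (QFO L) :=
  (((systemH L).union (systemL L)).union (systemS L)).union (systemQ L)

end TeamLogic

/-! Derivations are replaced by maximal consistent sets. By Lindenbaum's lemma, a formula belonging
to all of these "models" is a theorem of `HLSQ`, so provable equivalence reduces to membership in
the same models. The target is a finite disjunction of blocks `nf α l`: one classical α together
with strong negations of classical β.

The argument is that of a canonical model in modal logic. Linear implication from a fixed φ and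
shriek are normal boxes, so ⊗ and ∃ are diamonds with witnessing models (`exists_of_tensor`,
`exists_of_ex`) and distribute over disjunctions. It then suffices to compute them on blocks. With
the team reading as intuition, a block says that α holds throughout the team while each β fails
somewhere in it. Hence splitting into α with failures β and γ with failures δ amounts to α ∨ γ with
failures of α → β and γ → δ (`mem_tensor_nf`), and ∃x of a block amounts to ∃x α with failures of
∀x(α → β) (`mem_ex_nf`). In both cases failures are produced one at a time and collected by merging
overlapping splittings, which the lax axiom allows. The quantifier ∀x commutes with both Boolean
connectives and so acts inside blocks. -/

namespace TeamLogic

universe u v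

/-! ### Propositional Hilbert calculi and Lindenbaum's lemma -/

section Hilbert

variable {F : Type*} {imp : F → F → F} {neg : F → F}

/-- Sets of formulas that contain the axioms of classical propositional logic and are closed under
modus ponens. -/
structure IsTheory (imp : F → F → F) (neg : F → F) (T : Set F) : Prop where
  weaken (a b : F) : imp a (imp b a) ∈ T
  frege (a b c : F) : imp (imp a (imp b c)) (imp (imp a b) (imp a c)) ∈ T
  contra (a b : F) : imp (imp (neg a) (neg b)) (imp b a) ∈ T
  mp {a b : F} : a ∈ T → imp a b ∈ T → b ∈ T

/-- The sets of true formulas under some propositional valuation. -/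
structure IsValuation (imp : F → F → F) (neg : F → F) (V : Set F) : Prop where
  mem_imp {a b : F} : imp a b ∈ V ↔ (a ∈ V → b ∈ V)
  mem_neg {a : F} : neg a ∈ V ↔ a ∉ V

namespace IsTheory

variable {T : Set F} {a b : F}

theorem weakening (hT : IsTheory imp neg T) (ha : a ∈ T) : imp b a ∈ T :=
  hT.mp ha (hT.weaken a b)

theorem imp_self (hT : IsTheory imp neg T) : imp a a ∈ T :=
  hT.mp (hT.weaken a a) (hT.mp (hT.weaken a (imp a a)) (hT.frege a (imp a a) a))

/-- The deduction theorem in semantic dress: the consequences of an extra assumption form a theory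
again, so the lemmas on theories can be reused under hypotheses. -/
theorem adjoin (hT : IsTheory imp neg T) (c : F) : IsTheory imp neg {x | imp c x ∈ T} where
  weaken a b := hT.weakening (hT.weaken a b)
  frege a b d := hT.weakening (hT.frege a b d)
  contra a b := hT.weakening (hT.contra a b)
  mp {a b} ha hab := hT.mp ha (hT.mp hab (hT.frege c a b))

theorem exfalso (hT : IsTheory imp neg T) (h : neg a ∈ T) : imp a b ∈ T :=
  hT.mp (hT.weakening h) (hT.contra b a)

theorem neg_neg_imp (hT : IsTheory imp neg T) : imp (neg (neg a)) a ∈ T := by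
  have h := hT.adjoin (neg (neg a))
  have h1 : neg (neg a) ∈ {x | imp (neg (neg a)) x ∈ T} := hT.imp_self
  exact h.mp h1 (h.mp (h.exfalso h1) (h.contra _ _))

theorem imp_neg_neg (hT : IsTheory imp neg T) : imp a (neg (neg a)) ∈ T :=
  hT.mp hT.neg_neg_imp (hT.contra _ _)

theorem trans {c : F} (hT : IsTheory imp neg T) (hab : imp a b ∈ T) (hbc : imp b c ∈ T) :
    imp a c ∈ T :=
  (hT.adjoin a).mp hab (hT.weakening hbc)

theorem contrapose (hT : IsTheory imp neg T) (h : imp a b ∈ T) : imp (neg b) (neg a) ∈ T :=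
  hT.mp (hT.trans hT.neg_neg_imp (hT.trans h hT.imp_neg_neg)) (hT.contra _ _)

theorem of_neg_imp_self (hT : IsTheory imp neg T) (h : imp (neg a) a ∈ T) : a ∈ T := by
  have h1 := hT.adjoin (neg a)
  exact hT.mp h (hT.mp (h1.mp h (h1.exfalso (b := neg (imp (neg a) a)) hT.imp_self))
    (hT.contra a (imp (neg a) a)))

theorem by_cases (hT : IsTheory imp neg T) (h : imp a b ∈ T) (h' : imp (neg a) b ∈ T) : b ∈ T :=
  hT.of_neg_imp_self (hT.trans (hT.contrapose h) h')

/-- Lindenbaum's lemma. -/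
theorem exists_valuation (hT : IsTheory imp neg T) (ha : a ∉ T) :
    ∃ V, IsValuation imp neg V ∧ T ⊆ V ∧ a ∉ V := by
  obtain ⟨M, hTM, ⟨hM, haM⟩, hmax⟩ := zorn_subset_nonempty
    {S : Set F | IsTheory imp neg S ∧ a ∉ S} (by
      rintro c hc hchain ⟨S₀, hS₀⟩
      refine ⟨⋃₀ c, ⟨⟨?_, ?_, ?_, ?_⟩, ?_⟩, fun S hS => Set.subset_sUnion_of_mem hS⟩
      · exact fun x y => ⟨S₀, hS₀, (hc hS₀).1.weaken x y⟩
      · exact fun x y z => ⟨S₀, hS₀, (hc hS₀).1.frege x y z⟩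
      · exact fun x y => ⟨S₀, hS₀, (hc hS₀).1.contra x y⟩
      · rintro x y ⟨S, hS, hx⟩ ⟨S', hS', hxy⟩
        rcases hchain.total hS hS' with h | h
        · exact ⟨S', hS', (hc hS').1.mp (h hx) hxy⟩
        · exact ⟨S, hS, (hc hS).1.mp hx (h hxy)⟩
      · rintro ⟨S, hS, h⟩
        exact (hc hS).2 h) T ⟨hT, ha⟩
  -- By maximality, adjoining any x outside M must make a derivable.
  have key : ∀ x, x ∉ M → imp x a ∈ M := by
    intro x hx
    by_contra hxa
    exact hx (hmax (y := {y | imp x y ∈ M}) ⟨hM.adjoin x, hxa⟩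
      (fun y hy => hM.weakening hy) (show imp x x ∈ M from hM.imp_self))
  have hneg : ∀ x, neg x ∈ M ↔ x ∉ M := fun x =>
    ⟨fun h h' => haM (hM.mp h' (hM.exfalso h)),
      fun h => by_contra fun h' => haM (hM.by_cases (key _ h) (key _ h'))⟩
  refine ⟨M, ⟨fun {x y} => ⟨fun h hx => hM.mp hx h, fun h => ?_⟩, fun {x} => hneg x⟩, hTM, haM⟩
  by_cases hx : x ∈ M
  · exact hM.weakening (h hx)
  · exact hM.exfalso ((hneg x).2 hx)

end IsTheory

end Hilbert

/-! ### Theorems of `HLSQ` and maximal consistent sets -/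

variable {L : FirstOrder.Language.{u, v}}

/-- Theorems of the proof system `HLSQ`. -/
def Provable (φ : QFO L) : Prop := (HLSQ L).Derives ∅ φ

namespace Provable

theorem axiomH {α : FO L} (h : AxiomH α) : Provable (FO.toQFO α) :=
  .ax (Or.inl (Or.inl (Or.inl ⟨α, h, rfl⟩)))

theorem axiomL {φ : QFO L} (h : AxiomL φ) : Provable φ := .ax (Or.inl (Or.inl (Or.inr h)))

theorem axiomS {φ : QFO L} (h : AxiomS φ) : Provable φ := .ax (Or.inl (Or.inr h))

theorem axiomQ {φ : QFO L} (h : AxiomQ φ) : Provable φ := .ax (Or.inr h)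

theorem mp_fo {α β : FO L} (h : Provable (FO.toQFO α)) (h' : Provable (FO.toQFO (.imp α β))) :
    Provable (FO.toQFO β) := by
  refine .rule (P := [FO.toQFO α, FO.toQFO (.imp α β)])
    (Or.inl (Or.inl (Or.inl ⟨α, β, rfl⟩))) ?_
  simpa using ⟨h, h'⟩

theorem limp {φ : QFO L} (ψ : QFO L) (h : Provable φ) : Provable (ψ ⊸ φ) := by
  refine .thmRule (P := [φ]) (Or.inl (Or.inr ⟨φ, ψ, rfl⟩)) ?_
  rintro p hp
  exact List.mem_singleton.1 hp ▸ h

theorem shriek {φ : QFO L} (x : ℕ) (h : Provable φ) : Provable (QFO.shriek x φ) := by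
  refine .thmRule (P := [φ]) (Or.inr ⟨x, φ, rfl⟩) ?_
  rintro p hp
  exact List.mem_singleton.1 hp ▸ h

end Provable

theorem derives_mp {Φ : Set (QFO L)} {φ ψ : QFO L} (h : (HLSQ L).Derives Φ φ)
    (h' : (HLSQ L).Derives Φ (φ ▷ ψ)) : (HLSQ L).Derives Φ ψ := by
  refine .rule (P := [φ, φ ▷ ψ]) (Or.inl (Or.inl (Or.inr ⟨φ, ψ, rfl⟩))) ?_
  simpa using ⟨h, h'⟩

theorem ProofSystem.Derives.mono {Ξ : Type*} {Ω : ProofSystem Ξ} {Φ Φ' : Set Ξ} {ξ : Ξ}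
    (h : Ω.Derives Φ ξ) (hΦ : Φ ⊆ Φ') : Ω.Derives Φ' ξ := by
  induction h with
  | prem h => exact .prem (hΦ h)
  | ax h => exact .ax h
  | rule h _ ih => exact .rule h fun p hp => ih p hp hΦ
  | thmRule h h' _ => exact .thmRule h h'

theorem isTheory_provable : IsTheory QFO.mimp QFO.snot {φ : QFO L | Provable φ} where
  weaken φ ψ := .axiomL (.L1 φ ψ)
  frege φ ψ θ := .axiomL (.L2 φ ψ θ)
  contra φ ψ := .axiomL (.L3 φ ψ)
  mp h h' := derives_mp h h'

theorem isTheory_provable_fo : IsTheory Fm.imp Fm.neg {α : FO L | Provable (FO.toQFO α)} where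
  weaken α β := .axiomH (.A1 α β)
  frege α β γ := .axiomH (.A2 α β γ)
  contra α β := .axiomH (.A3 α β)
  mp h h' := .mp_fo h h'

theorem provable_of_tautology {α : FO L} (h : ∀ V, IsValuation Fm.imp Fm.neg V → α ∈ V) :
    Provable (FO.toQFO α) := by
  by_contra hα
  obtain ⟨V, hV, -, hαV⟩ := isTheory_provable_fo.exists_valuation (a := α) hα
  exact hαV (h V hV)

/-- Valuations that make all theorems true, that is, maximal consistent sets of formulas. -/
structure IsModel (V : Set (QFO L)) : Prop extends IsValuation QFO.mimp QFO.snot V where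
  mem_of_provable {φ : QFO L} : Provable φ → φ ∈ V

theorem provable_of_forall_model {φ : QFO L} (h : ∀ V, IsModel V → φ ∈ V) : Provable φ := by
  by_contra hφ
  obtain ⟨V, hV, hT, hφV⟩ := isTheory_provable.exists_valuation (a := φ) hφ
  exact hφV (h V { toIsValuation := hV, mem_of_provable := fun h => hT h })

/-! ### Normal modal operators -/

/-- Unary connectives with necessitation and distribution over material implication. -/
structure IsNormal (B : QFO L → QFO L) : Prop where
  nec {φ : QFO L} : Provable φ → Provable (B φ)
  distrib (φ ψ : QFO L) : Provable (B (φ ▷ ψ) ▷ (B φ ▷ B ψ))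

theorem isNormal_limp (φ : QFO L) : IsNormal (φ ⊸ ·) where
  nec h := h.limp φ
  distrib ψ θ := .axiomS (.distrib φ ψ θ)

theorem isNormal_shriek (x : ℕ) : IsNormal (L := L) (QFO.shriek x) where
  nec h := h.shriek x
  distrib φ ψ := .axiomQ (.distribShriek x φ ψ)

/-! ### Normal forms -/

/-- Finite conjunctions of a classical formula and strongly negated classical formulas. -/
def nf (α : FO L) : List (FO L) → QFO L
  | [] => FO.toQFO α
  | β :: l => QFO.sand ∼ₜ(FO.toQFO β) (nf α l)

/-- Finite disjunctions of formulas `nf α l`. -/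
def dnf : List (FO L × List (FO L)) → QFO L
  | [] => ∼ₜ(FO.toQFO (.equal (.var 0) (.var 0)) ▷ FO.toQFO (.equal (.var 0) (.var 0)))
  | p :: l => ∼ₜ(nf p.1 p.2) ▷ dnf l

/-! ### Modal reasoning inside a maximal consistent set -/

namespace IsModel

variable {V : Set (QFO L)} {φ φ' ψ ψ' θ χ : QFO L} {α β γ : FO L} {x : ℕ}

theorem mem_sand (hV : IsModel V) : QFO.sand φ ψ ∈ V ↔ φ ∈ V ∧ ψ ∈ V := by
  simp only [QFO.sand, hV.mem_neg, hV.mem_imp]; tauto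

theorem mem_congr (hV : IsModel V) (h : Provable (φ ◁▷ ψ)) : φ ∈ V ↔ ψ ∈ V := by
  have := hV.mem_of_provable h
  simp only [QFO.miff, hV.mem_sand, hV.mem_imp] at this
  exact ⟨this.1, this.2⟩

theorem mp (hV : IsModel V) (h : Provable (φ ▷ ψ)) (hφ : φ ∈ V) : ψ ∈ V :=
  hV.mem_imp.1 (hV.mem_of_provable h) hφ

theorem mp_fo (hV : IsModel V) (h : FO.toQFO (.imp α β) ∈ V) (hα : FO.toQFO α ∈ V) :
    FO.toQFO β ∈ V :=
  hV.mem_imp.1 (hV.mp (.axiomL (.L4 α β)) h) hα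

/-- Classical formulas in a model are closed under tautological consequence. -/
theorem taut (hV : IsModel V) (h : ∀ W, IsValuation Fm.imp Fm.neg W → α ∈ W → β ∈ W)
    (hα : FO.toQFO α ∈ V) : FO.toQFO β ∈ V :=
  hV.mp_fo (hV.mem_of_provable (provable_of_tautology fun W hW => hW.mem_imp.2 (h W hW))) hα

theorem taut₂ (hV : IsModel V)
    (h : ∀ W, IsValuation Fm.imp Fm.neg W → α ∈ W → β ∈ W → γ ∈ W)
    (hα : FO.toQFO α ∈ V) (hβ : FO.toQFO β ∈ V) : FO.toQFO γ ∈ V :=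
  hV.mp_fo (hV.taut (fun W hW hα => hW.mem_imp.2 (h W hW hα)) hα) hβ

/-- The existence lemma of canonical models: normality makes the formulas boxed in V a theory, which
Lindenbaum's lemma extends while avoiding φ. -/
theorem exists_of_not_mem {B : QFO L → QFO L} (hV : IsModel V) (hB : IsNormal B)
    (h : B φ ∉ V) : ∃ S, IsModel S ∧ φ ∉ S ∧ ∀ χ, B χ ∈ V → χ ∈ S := by
  have hT : IsTheory QFO.mimp QFO.snot {χ | B χ ∈ V} :=
    { weaken := fun a b => hV.mem_of_provable (hB.nec (.axiomL (.L1 a b)))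
      frege := fun a b c => hV.mem_of_provable (hB.nec (.axiomL (.L2 a b c)))
      contra := fun a b => hV.mem_of_provable (hB.nec (.axiomL (.L3 a b)))
      mp := fun ha hab => hV.mem_imp.1 (hV.mp (hB.distrib _ _) hab) ha }
  obtain ⟨S, hS, hTS, hφ⟩ := hT.exists_valuation (a := φ) h
  exact ⟨S, { toIsValuation := hS
              mem_of_provable := fun h => hTS (hV.mem_of_provable (hB.nec h)) }, hφ,
    fun χ hχ => hTS hχ⟩

theorem box_mono {B : QFO L → QFO L} (hV : IsModel V) (hB : IsNormal B)
    (h : ∀ S, IsModel S → φ ∈ S → ψ ∈ S) (hφ : B φ ∈ V) : B ψ ∈ V := by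
  by_contra hψ
  obtain ⟨S, hS, hψS, hS'⟩ := hV.exists_of_not_mem hB hψ
  exact hψS (h S hS (hS' _ hφ))

theorem box_not_not {B : QFO L → QFO L} (hV : IsModel V) (hB : IsNormal B) :
    B ∼ₜ∼ₜφ ∈ V ↔ B φ ∈ V :=
  ⟨hV.box_mono hB fun S hS h => by simpa [hS.mem_neg] using h,
    hV.box_mono hB fun S hS h => by simpa [hS.mem_neg] using h⟩

theorem tensor_comm (hV : IsModel V) (h : φ ⊗ᵗ ψ ∈ V) : ψ ⊗ᵗ φ ∈ V := by
  simp only [QFO.tensor, hV.mem_neg] at h ⊢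
  exact fun h' => h (hV.mp (.axiomS (.contra ψ φ)) h')

theorem mem_limp (hV : IsModel V) : (φ ⊸ ψ) ∈ V ↔ φ ⊗ᵗ ∼ₜψ ∉ V := by
  rw [QFO.tensor, hV.mem_neg, not_not]
  exact (hV.box_not_not (isNormal_limp φ)).symm

theorem mem_shriek (hV : IsModel V) : QFO.shriek x φ ∈ V ↔ QFO.ex x ∼ₜφ ∉ V := by
  rw [QFO.ex, hV.mem_neg, not_not]
  exact (hV.box_not_not (isNormal_shriek x)).symm

/-- S plays the role of the subteam satisfying ψ. It inherits the classical formulas of V because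
these are flat. -/
theorem exists_of_tensor (hV : IsModel V) (h : φ ⊗ᵗ ψ ∈ V) :
    ∃ S, IsModel S ∧ ψ ∈ S ∧ (∀ χ ∈ S, φ ⊗ᵗ χ ∈ V) ∧
      ∀ α, FO.toQFO α ∈ V → FO.toQFO α ∈ S := by
  obtain ⟨S, hS, hψ, hS'⟩ := hV.exists_of_not_mem (isNormal_limp φ) (hV.mem_neg.1 h)
  refine ⟨S, hS, by simpa [hS.mem_neg] using hψ, fun χ hχ => hV.mem_neg.2 fun h' => ?_,
    fun α hα => hS' _ (hV.mp (.axiomS (.flatLimp φ α)) hα)⟩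
  exact hS.mem_neg.1 (hS' _ h') hχ

theorem exists_of_ex (hV : IsModel V) (h : QFO.ex x φ ∈ V) :
    ∃ S, IsModel S ∧ φ ∈ S ∧ (∀ χ ∈ S, QFO.ex x χ ∈ V) ∧
      ∀ α, FO.toQFO (.all x α) ∈ V → FO.toQFO α ∈ S := by
  obtain ⟨S, hS, hφ, hS'⟩ := hV.exists_of_not_mem (isNormal_shriek x) (hV.mem_neg.1 h)
  refine ⟨S, hS, by simpa [hS.mem_neg] using hφ, fun χ hχ => hV.mem_neg.2 fun h' => ?_,
    fun α hα => hS' _ (hV.mp (.axiomQ (.elimAll x α)) hα)⟩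
  exact hS.mem_neg.1 (hS' _ h') hχ

theorem tensor_mono_right (hV : IsModel V) (h : ∀ S, IsModel S → ψ ∈ S → ψ' ∈ S)
    (hφ : φ ⊗ᵗ ψ ∈ V) : φ ⊗ᵗ ψ' ∈ V := by
  obtain ⟨S, hS, hψ, hS', -⟩ := hV.exists_of_tensor hφ
  exact hS' _ (h S hS hψ)

theorem tensor_mono (hV : IsModel V) (h : ∀ S, IsModel S → φ ∈ S → φ' ∈ S)
    (h' : ∀ S, IsModel S → ψ ∈ S → ψ' ∈ S) (hφ : φ ⊗ᵗ ψ ∈ V) : φ' ⊗ᵗ ψ' ∈ V :=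
  hV.tensor_comm (hV.tensor_mono_right h (hV.tensor_comm (hV.tensor_mono_right h' hφ)))

theorem ex_mono (hV : IsModel V) (h : ∀ S, IsModel S → φ ∈ S → ψ ∈ S)
    (hφ : QFO.ex x φ ∈ V) : QFO.ex x ψ ∈ V := by
  obtain ⟨S, hS, hψ, hS', -⟩ := hV.exists_of_ex hφ
  exact hS' _ (h S hS hψ)

theorem tensor_left_comm (hV : IsModel V) (h : φ ⊗ᵗ (ψ ⊗ᵗ θ) ∈ V) : ψ ⊗ᵗ (φ ⊗ᵗ θ) ∈ V := by
  have key : ∀ a b c : QFO L, a ⊗ᵗ (b ⊗ᵗ c) ∈ V ↔ (a ⊸ (b ⊸ ∼ₜc)) ∉ V := fun a b c => by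
    rw [QFO.tensor, QFO.tensor, hV.mem_neg]
    exact not_congr (hV.box_not_not (isNormal_limp a))
  rw [key] at h ⊢
  exact fun h' => h (hV.mp (.axiomS (.exchange _ _ _)) h')

/-- Left-commutativity together with commutativity lets the four factors be permuted freely. -/
theorem tensor_tensor_comm (hV : IsModel V) (h : (φ ⊗ᵗ φ') ⊗ᵗ (ψ ⊗ᵗ ψ') ∈ V) :
    (φ ⊗ᵗ ψ) ⊗ᵗ (φ' ⊗ᵗ ψ') ∈ V := by
  have h1 : ψ ⊗ᵗ (φ ⊗ᵗ (φ' ⊗ᵗ ψ')) ∈ V :=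
    hV.tensor_mono_right (fun S hS h => hS.tensor_mono_right (fun _ h => h.tensor_comm)
      (hS.tensor_left_comm (hS.tensor_comm h))) (hV.tensor_left_comm h)
  exact hV.tensor_comm (hV.tensor_left_comm
    (hV.tensor_mono_right (fun _ h => h.tensor_comm) (hV.tensor_left_comm h1)))

theorem mem_disj (hV : IsModel V) :
    FO.toQFO α ⊗ᵗ FO.toQFO β ∈ V ↔ FO.toQFO (FO.disj α β) ∈ V :=
  hV.mem_congr (.axiomS (.flatTensor α β))

/-- Splittings may overlap, so the left part can be enlarged to the whole team, where φ holds. -/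
theorem tensor_lax (hV : IsModel V) (hφ : φ ∈ V) (h : θ ⊗ᵗ χ ∈ V) : φ ⊗ᵗ χ ∈ V := by
  simp only [QFO.tensor, hV.mem_neg] at h ⊢
  exact fun h' => h (hV.mem_imp.1 (hV.mp (.axiomS (.lax φ (∼ₜχ) θ)) hφ) h')

theorem tensor_self (hV : IsModel V) (hφ : φ ∈ V) : φ ⊗ᵗ φ ∈ V := by
  let α : FO L := .equal (.var 0) (.var 0)
  -- Some splitting is needed to start from; a valid α gives one, and laxness then replaces both
  -- sides.
  have h : FO.toQFO α ⊗ᵗ FO.toQFO α ∈ V :=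
    hV.mem_disj.2 (hV.taut (fun W hW h => hW.mem_imp.2 fun _ => h)
      (hV.mem_of_provable (.axiomH (.A6 0))))
  exact hV.tensor_lax hφ (hV.tensor_comm (hV.tensor_lax hφ h))

/-- Two splittings of a team can be merged. -/
theorem tensor_merge (hV : IsModel V) (h : φ ⊗ᵗ ψ ∈ V) (h' : φ' ⊗ᵗ ψ' ∈ V) :
    (φ ⊗ᵗ φ') ⊗ᵗ (ψ ⊗ᵗ ψ') ∈ V := by
  -- Both parts are taken to be the whole team; each is then split, one by h and the other by h'.
  have h1 := hV.tensor_self (hV.mem_sand.2 ⟨h, h'⟩)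
  exact hV.tensor_tensor_comm (hV.tensor_mono (fun S hS h => (hS.mem_sand.1 h).1)
    (fun S hS h => (hS.mem_sand.1 h).2) h1)

theorem mem_ex_tensor (hV : IsModel V) :
    QFO.ex x (φ ⊗ᵗ ψ) ∈ V ↔ QFO.ex x φ ⊗ᵗ QFO.ex x ψ ∈ V :=
  hV.mem_congr (.axiomQ (.exTensor x φ ψ))

theorem mem_ex (hV : IsModel V) :
    QFO.ex x (FO.toQFO α) ∈ V ↔ FO.toQFO (.neg (.all x (.neg α))) ∈ V :=
  hV.mem_congr (.axiomQ (.flatEx x α))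

/-- The team quantifier ∀x is functional: it sends a team to a single team, so it commutes with
strong negation, and the formulas it makes true form a complete theory. -/
theorem preimage_all (hV : IsModel V) (x : ℕ) : IsModel {φ | QFO.all x φ ∈ V} where
  mem_neg {φ} := (hV.mem_congr (.axiomQ (.linAll x φ))).trans hV.mem_neg
  mem_imp {φ ψ} := by
    have hth : ∀ {φ}, Provable φ → QFO.all x φ ∈ V := fun h =>
      hV.mp (.axiomQ (.introAll x _)) (hV.mem_of_provable (h.shriek x))
    have hmp : ∀ {φ ψ}, QFO.all x (φ ▷ ψ) ∈ V → QFO.all x φ ∈ V → QFO.all x ψ ∈ V :=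
      fun h h' => hV.mem_imp.1 (hV.mp (.axiomQ (.distribAll x _ _)) h) h'
    refine ⟨hmp, fun h => ?_⟩
    by_cases hφ : QFO.all x φ ∈ V
    · exact hmp (hth (.axiomL (.L1 ψ φ))) (h hφ)
    · have h1 : QFO.all x ∼ₜφ ∈ V :=
        (hV.mem_congr (.axiomQ (.linAll x φ))).2 (hV.mem_neg.2 hφ)
      refine hmp (hth (provable_of_forall_model fun W hW => ?_)) h1
      simp only [hW.mem_imp, hW.mem_neg]
      tauto
  mem_of_provable h := hV.mp (.axiomQ (.introAll x _)) (hV.mem_of_provable (h.shriek x))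

/-! ### Tensors of blocks -/

theorem mem_nf (hV : IsModel V) {l : List (FO L)} :
    nf α l ∈ V ↔ FO.toQFO α ∈ V ∧ ∀ β ∈ l, FO.toQFO β ∉ V := by
  induction l with
  | nil => simp [nf]
  | cons β l ih =>
    simp only [nf, hV.mem_sand, hV.mem_neg, ih, List.forall_mem_cons]
    tauto

theorem mem_dnf (hV : IsModel V) {l : List (FO L × List (FO L))} :
    dnf l ∈ V ↔ ∃ p ∈ l, nf p.1 p.2 ∈ V := by
  induction l with
  | nil => simp [dnf, hV.mem_neg, hV.mem_imp]
  | cons p l ih =>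
    simp only [dnf, hV.mem_imp, hV.mem_neg, ih, List.exists_mem_cons_iff]
    tauto

/-- Classical formulas pass to subteams, so a failure in a part is a failure in the whole. -/
theorem not_mem_of_tensor {β : FO L} (hV : IsModel V) (h : φ ⊗ᵗ ψ ∈ V)
    (hψ : ∀ S, IsModel S → ψ ∈ S → FO.toQFO β ∉ S) : FO.toQFO β ∉ V := by
  obtain ⟨S, hS, hψS, -, hS'⟩ := hV.exists_of_tensor h
  exact fun hβ => hψ S hS hψS (hS' _ hβ)

theorem nf_append (hV : IsModel V) {l m : List (FO L)} (h : nf α l ⊗ᵗ nf α m ∈ V) :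
    nf α (l ++ m) ∈ V := by
  refine hV.mem_nf.2 ⟨?_, fun β hβ => ?_⟩
  · refine hV.taut (α := FO.disj α α) (fun W hW h => ?_) (hV.mem_disj.1 (hV.tensor_mono
      (fun S hS h => (hS.mem_nf.1 h).1) (fun S hS h => (hS.mem_nf.1 h).1) h))
    simp only [FO.disj, hW.mem_imp, hW.mem_neg] at h
    tauto
  · rcases List.mem_append.1 hβ with hβ | hβ
    · exact hV.not_mem_of_tensor (hV.tensor_comm h) fun S hS h => (hS.mem_nf.1 h).2 _ hβ
    · exact hV.not_mem_of_tensor h fun S hS h => (hS.mem_nf.1 h).2 _ hβ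

/-- Split the team into its α-part and its ¬α-part, the latter satisfying γ. If β held on the
α-part, then α → β would hold on both parts, hence everywhere. -/
theorem tensor_nf_singleton (hV : IsModel V) (h : FO.toQFO (FO.disj α γ) ∈ V)
    (hβ : FO.toQFO (.imp α β) ∉ V) : nf α [β] ⊗ᵗ FO.toQFO γ ∈ V := by
  have h1 : FO.toQFO α ⊗ᵗ FO.toQFO (.neg α) ∈ V :=
    hV.mem_disj.2 (hV.mem_of_provable (provable_of_tautology fun W hW => by
      simp [FO.disj, hW.mem_imp, hW.mem_neg]))
  obtain ⟨S, hS, hSα, hSt, hSf⟩ := hV.exists_of_tensor h1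
  -- Besides ¬α, the part S contains γ, since α ∨ γ unfolds to ¬α → γ.
  have h2 := hV.tensor_comm (hSt _ (hS.mem_sand.2 ⟨hSα, hS.mp_fo (hSf _ h) hSα⟩))
  obtain ⟨U, hU, hUα, hUt, -⟩ := hV.exists_of_tensor h2
  by_cases hUβ : FO.toQFO β ∈ U
  · refine absurd (hV.taut (α := FO.disj (.imp α β) (.imp α β)) (fun W hW h => ?_)
      (hV.mem_disj.1 (hV.tensor_mono (fun S hS h => ?_) (fun S hS h => ?_) (hUt _ hUβ)))) hβ
    · simp only [FO.disj, hW.mem_imp, hW.mem_neg] at h ⊢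
      tauto
    · refine hS.taut (fun W hW h => ?_) (hS.mem_sand.1 h).1
      simp only [hW.mem_imp, hW.mem_neg] at h ⊢
      tauto
    · exact hS.taut (fun W hW h => hW.mem_imp.2 fun _ => h) h
  · exact hV.tensor_comm (hV.tensor_mono (fun S hS h => (hS.mem_sand.1 h).2) (fun _ _ h => h)
      (hUt (nf α [β]) (hU.mem_nf.2 ⟨hUα, by simpa using hUβ⟩)))

theorem tensor_nf_left (hV : IsModel V) (h : FO.toQFO (FO.disj α γ) ∈ V) {l : List (FO L)}
    (hl : ∀ β ∈ l, FO.toQFO (.imp α β) ∉ V) : nf α l ⊗ᵗ nf γ [] ∈ V := by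
  induction l with
  | nil => exact hV.mem_disj.2 h
  | cons β l ih =>
    rw [List.forall_mem_cons] at hl
    -- Merging the splitting that refutes β with the one that refutes the rest collects all failures
    -- on the left.
    exact hV.tensor_mono (fun S hS h => hS.nf_append (l := [β]) h)
      (fun S hS h => hS.nf_append (l := []) h)
      (hV.tensor_merge (hV.tensor_nf_singleton h hl.1) (ih hl.2))

theorem mem_tensor_nf (hV : IsModel V) {l m : List (FO L)} :
    nf α l ⊗ᵗ nf γ m ∈ V ↔
      nf (FO.disj α γ) (l.map (Fm.imp α) ++ m.map (Fm.imp γ)) ∈ V := by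
  constructor
  · intro h
    refine hV.mem_nf.2 ⟨hV.mem_disj.1 (hV.tensor_mono (fun S hS h => (hS.mem_nf.1 h).1)
      (fun S hS h => (hS.mem_nf.1 h).1) h), fun δ hδ => ?_⟩
    rcases List.mem_append.1 hδ with hδ | hδ <;> obtain ⟨β, hβ, rfl⟩ := List.mem_map.1 hδ
    · exact hV.not_mem_of_tensor (hV.tensor_comm h) fun S hS h h' =>
        (hS.mem_nf.1 h).2 β hβ (hS.mp_fo h' (hS.mem_nf.1 h).1)
    · exact hV.not_mem_of_tensor h fun S hS h h' =>
        (hS.mem_nf.1 h).2 β hβ (hS.mp_fo h' (hS.mem_nf.1 h).1)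
  · intro h
    obtain ⟨h, hlm⟩ := hV.mem_nf.1 h
    have h1 : nf α l ⊗ᵗ nf γ [] ∈ V := hV.tensor_nf_left h fun β hβ =>
      hlm _ (List.mem_append_left _ (List.mem_map_of_mem hβ))
    have h2 : nf γ m ⊗ᵗ nf α [] ∈ V :=
      hV.tensor_nf_left (hV.mem_disj.1 (hV.tensor_comm (hV.mem_disj.2 h))) fun β hβ =>
        hlm _ (List.mem_append_right _ (List.mem_map_of_mem hβ))
    refine hV.tensor_mono (fun S hS h => ?_) (fun S hS h => hS.nf_append (l := []) h)
      (hV.tensor_merge h1 (hV.tensor_comm h2))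
    simpa using hS.nf_append h

/-! ### Existential quantification of blocks -/

/-- A failure of ∀x(α → β) yields a part of the team where ∃x(α ∧ ¬β) holds robustly; choosing x
there to refute β, and elsewhere only to satisfy α, works because ∃x commutes with ⊗. -/
theorem ex_nf_singleton (hV : IsModel V) (h : FO.toQFO (.neg (.all x (.neg α))) ∈ V)
    (hβ : FO.toQFO (.all x (.imp α β)) ∉ V) : QFO.ex x (nf α [β]) ∈ V := by
  let κ : FO L := .neg (.imp α β)
  let ε : FO L := .neg (.all x (.neg κ))
  -- The strongly negated entry keeps the part with ε from being the empty team, which would satisfy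
  -- every classical formula.
  have h1 : nf ε [.all x (.neg κ)] ⊗ᵗ FO.toQFO (.neg (.all x (.neg α))) ∈ V := by
    refine hV.tensor_nf_singleton (hV.taut (fun W hW h => hW.mem_imp.2 fun _ => h) h)
      fun h' => hβ ?_
    have h2 : FO.toQFO (.all x (.neg κ)) ∈ V := hV.taut (fun W hW h => by
      simp only [ε, hW.mem_imp, hW.mem_neg] at h
      tauto) h'
    exact (hV.preimage_all x).taut (α := .neg κ) (β := .imp α β)
      (fun W hW h => by simpa [κ, hW.mem_neg] using h) h2
  have h2 : QFO.ex x (nf α [β]) ⊗ᵗ QFO.ex x (nf α []) ∈ V := by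
    refine hV.tensor_mono (fun S hS hε => ?_) (fun S hS h => hS.mem_ex.2 h) h1
    obtain ⟨hε, hκ⟩ := hS.mem_nf.1 hε
    obtain ⟨U, hU, hUκ, hUe, -⟩ := hS.exists_of_ex (hS.mem_ex.2 hε)
    have hUα : FO.toQFO α ∈ U := hU.taut (fun W hW h => by
      simp only [κ, hW.mem_imp, hW.mem_neg] at h
      tauto) hUκ
    refine hUe _ (hU.mem_nf.2 ⟨hUα, fun β' hβ' hUβ => ?_⟩)
    obtain rfl := List.mem_singleton.1 hβ'
    -- If β held in U, then U would contain a classical contradiction, S would contain both its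
    -- existential quantification and the negation of that, and so S would contain ∀x ¬κ.
    have hbot : FO.toQFO (.neg (.imp α α)) ∈ U := hU.taut₂ (fun W hW h h' => by
      simp only [κ, hW.mem_imp, hW.mem_neg] at h
      tauto) hUκ hUβ
    have htop : FO.toQFO (.neg (.neg (.imp α α))) ∈ {φ | QFO.all x φ ∈ S} :=
      (hS.preimage_all x).mem_of_provable (provable_of_tautology fun W hW => by
        simp [hW.mem_imp, hW.mem_neg])
    exact hκ _ (List.mem_singleton_self _) (hS.taut₂
      (fun W hW h h' => absurd h' (hW.mem_neg.1 h)) (hS.mem_ex.1 (hUe _ hbot)) htop)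
  exact hV.ex_mono (fun S hS h => hS.nf_append (l := [β]) (m := []) h) (hV.mem_ex_tensor.2 h2)

theorem mem_ex_nf (hV : IsModel V) {l : List (FO L)} :
    QFO.ex x (nf α l) ∈ V ↔
      nf (.neg (.all x (.neg α))) (l.map fun β => .all x (.imp α β)) ∈ V := by
  constructor
  · intro h
    refine hV.mem_nf.2 ⟨hV.mem_ex.1 (hV.ex_mono (fun S hS h => (hS.mem_nf.1 h).1) h),
      fun δ hδ h' => ?_⟩
    obtain ⟨β, hβ, rfl⟩ := List.mem_map.1 hδ
    obtain ⟨S, hS, hSn, -, hSf⟩ := hV.exists_of_ex h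
    exact (hS.mem_nf.1 hSn).2 β hβ (hS.mp_fo (hSf _ h') (hS.mem_nf.1 hSn).1)
  · intro h
    rw [hV.mem_nf] at h
    obtain ⟨h, hl⟩ := h
    induction l with
    | nil => exact hV.mem_ex.2 h
    | cons β l ih =>
      rw [List.map_cons, List.forall_mem_cons] at hl
      -- Duplicating the team allows a separate choice of x for β and for the remaining list.
      have h1 := hV.tensor_self (hV.mem_sand.2
        ⟨hV.ex_nf_singleton h hl.1, ih hl.2⟩)
      exact hV.ex_mono (fun S hS h => hS.nf_append (l := [β]) h) (hV.mem_ex_tensor.2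
        (hV.tensor_mono (fun S hS h => (hS.mem_sand.1 h).1)
          (fun S hS h => (hS.mem_sand.1 h).2) h1))

end IsModel

/-! ### Closure of disjunctive normal forms under all connectives -/

/-- The formula is provably equivalent to one in disjunctive normal form. -/
def HasDnf (φ : QFO L) : Prop := ∃ l, ∀ V, IsModel V → (φ ∈ V ↔ dnf l ∈ V)

namespace HasDnf

variable {φ ψ : QFO L}

theorem congr (hφ : HasDnf φ) (h : ∀ V, IsModel V → (ψ ∈ V ↔ φ ∈ V)) : HasDnf ψ :=
  hφ.imp fun _ hl V hV => (h V hV).trans (hl V hV)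

theorem nf (α : FO L) (l : List (FO L)) : HasDnf (nf α l) :=
  ⟨[(α, l)], fun V hV => by simp [hV.mem_dnf]⟩

theorem fo (α : FO L) : HasDnf (FO.toQFO α) := nf α []

/-- Formulas that hold in the same models as a finite disjunction have a normal form if the
disjuncts do. -/
theorem of_exists {ι : Type*} (l : List ι) (f : ι → QFO L) (hf : ∀ i ∈ l, HasDnf (f i))
    (h : ∀ V, IsModel V → (φ ∈ V ↔ ∃ i ∈ l, f i ∈ V)) : HasDnf φ := by
  choose! g hg using hf
  refine ⟨l.flatMap fun i => g i, fun V hV => (h V hV).trans ?_⟩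
  simp only [hV.mem_dnf, List.mem_flatMap]
  constructor
  · rintro ⟨i, hi, h⟩
    obtain ⟨p, hp, h⟩ := hV.mem_dnf.1 ((hg i hi V hV).1 h)
    exact ⟨p, ⟨i, hi, hp⟩, h⟩
  · rintro ⟨p, ⟨i, hi, hp⟩, h⟩
    exact ⟨i, hi, (hg i hi V hV).2 (hV.mem_dnf.2 ⟨p, hp, h⟩)⟩

theorem sand_nf (α β : FO L) (l m : List (FO L)) :
    HasDnf (QFO.sand (TeamLogic.nf α l) (TeamLogic.nf β m)) := by
  refine (nf (.neg (.imp α (.neg β))) (l ++ m)).congr fun V hV => ?_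
  have : FO.toQFO (.neg (.imp α (.neg β))) ∈ V ↔ FO.toQFO α ∈ V ∧ FO.toQFO β ∈ V := by
    refine ⟨fun h => ⟨hV.taut (fun W hW h => ?_) h, hV.taut (fun W hW h => ?_) h⟩,
      fun h => hV.taut₂ (fun W hW h h' => ?_) h.1 h.2⟩
    all_goals
      simp only [hW.mem_imp, hW.mem_neg] at *
      tauto
  simp only [hV.mem_sand, hV.mem_nf, this, List.forall_mem_append]
  tauto

theorem sand (hφ : HasDnf φ) (hψ : HasDnf ψ) : HasDnf (QFO.sand φ ψ) := by
  obtain ⟨l, hl⟩ := hφ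
  obtain ⟨m, hm⟩ := hψ
  refine of_exists (l ×ˢ m)
    (fun p => QFO.sand (TeamLogic.nf p.1.1 p.1.2) (TeamLogic.nf p.2.1 p.2.2))
    (fun p _ => sand_nf _ _ _ _) fun V hV => ?_
  simp only [hV.mem_sand, hl V hV, hm V hV, hV.mem_dnf]
  constructor
  · rintro ⟨⟨p, hp, h⟩, q, hq, h'⟩
    exact ⟨(p, q), List.pair_mem_product.2 ⟨hp, hq⟩, h, h'⟩
  · rintro ⟨⟨p, q⟩, hpq, h, h'⟩
    obtain ⟨hp, hq⟩ := List.pair_mem_product.1 hpq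
    exact ⟨⟨p, hp, h⟩, q, hq, h'⟩

theorem mimp_snot (hφ : HasDnf φ) (hψ : HasDnf ψ) : HasDnf (∼ₜφ ▷ ψ) := by
  refine of_exists [φ, ψ] id (by simpa using ⟨hφ, hψ⟩) fun V hV => ?_
  simp only [hV.mem_imp, hV.mem_neg, List.exists_mem_cons_iff, id]
  simp
  tauto

theorem snot_nf (α : FO L) (l : List (FO L)) : HasDnf ∼ₜ(TeamLogic.nf α l) := by
  induction l with
  | nil =>
    -- A block needs a classical component, here the tautology α → α.
    refine (nf (.imp α α) [α]).congr fun V hV => ?_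
    have : FO.toQFO (.imp α α) ∈ V :=
      hV.mem_of_provable (provable_of_tautology fun W hW => hW.mem_imp.2 id)
    simp [hV.mem_neg, hV.mem_nf, this]
  | cons β l ih =>
    refine ((fo β).mimp_snot ih).congr fun V hV => ?_
    simp only [TeamLogic.nf, hV.mem_neg, hV.mem_sand, hV.mem_imp]
    tauto

theorem snot_dnf (l : List (FO L × List (FO L))) : HasDnf ∼ₜ(dnf l) := by
  induction l with
  | nil =>
    let α : FO L := .equal (.var 0) (.var 0)
    refine (fo (.imp α α)).congr fun V hV => ?_
    have : FO.toQFO (.imp α α) ∈ V :=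
      hV.mem_of_provable (provable_of_tautology fun W hW => hW.mem_imp.2 id)
    simp [this, dnf, hV.mem_neg, hV.mem_imp]
  | cons p l ih =>
    refine ((snot_nf p.1 p.2).sand ih).congr fun V hV => ?_
    simp only [dnf, hV.mem_neg, hV.mem_sand, hV.mem_imp]
    tauto

theorem snot (hφ : HasDnf φ) : HasDnf ∼ₜφ := by
  obtain ⟨l, hl⟩ := hφ
  exact (snot_dnf l).congr fun V hV => by rw [hV.mem_neg, hV.mem_neg, hl V hV]

theorem mimp (hφ : HasDnf φ) (hψ : HasDnf ψ) : HasDnf (φ ▷ ψ) :=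
  (hφ.snot.mimp_snot hψ).congr fun V hV => by simp [hV.mem_imp, hV.mem_neg]

theorem tensor (hφ : HasDnf φ) (hψ : HasDnf ψ) : HasDnf (φ ⊗ᵗ ψ) := by
  obtain ⟨l, hl⟩ := hφ
  obtain ⟨m, hm⟩ := hψ
  refine of_exists (l ×ˢ m) (fun p => TeamLogic.nf p.1.1 p.1.2 ⊗ᵗ TeamLogic.nf p.2.1 p.2.2)
    (fun p _ => (nf _ _).congr fun V hV => hV.mem_tensor_nf) fun V hV => ?_
  constructor
  · intro h
    -- The tensor distributes over disjunction one side at a time: the witness for each side decides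
    -- which disjunct holds.
    obtain ⟨S, hS, hψ, hS', -⟩ := hV.exists_of_tensor h
    obtain ⟨q, hq, hqS⟩ := hS.mem_dnf.1 ((hm S hS).1 hψ)
    obtain ⟨U, hU, hφ, hU', -⟩ := hV.exists_of_tensor (hV.tensor_comm (hS' _ hqS))
    obtain ⟨p, hp, hpU⟩ := hU.mem_dnf.1 ((hl U hU).1 hφ)
    exact ⟨(p, q), List.pair_mem_product.2 ⟨hp, hq⟩, hV.tensor_comm (hU' _ hpU)⟩
  · rintro ⟨⟨p, q⟩, hpq, h⟩
    obtain ⟨hp, hq⟩ := List.pair_mem_product.1 hpq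
    exact hV.tensor_mono (fun S hS h => (hl S hS).2 (hS.mem_dnf.2 ⟨p, hp, h⟩))
      (fun S hS h => (hm S hS).2 (hS.mem_dnf.2 ⟨q, hq, h⟩)) h

theorem limp (hφ : HasDnf φ) (hψ : HasDnf ψ) : HasDnf (φ ⊸ ψ) :=
  (hφ.tensor hψ.snot).snot.congr fun V hV => by rw [hV.mem_limp, hV.mem_neg]

theorem ex (hφ : HasDnf φ) (x : ℕ) : HasDnf (QFO.ex x φ) := by
  obtain ⟨l, hl⟩ := hφ
  refine of_exists l (fun p => QFO.ex x (TeamLogic.nf p.1 p.2))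
    (fun p _ => (nf _ _).congr fun V hV => hV.mem_ex_nf) fun V hV => ?_
  constructor
  · intro h
    obtain ⟨S, hS, hφ, hS', -⟩ := hV.exists_of_ex h
    obtain ⟨p, hp, hpS⟩ := hS.mem_dnf.1 ((hl S hS).1 hφ)
    exact ⟨p, hp, hS' _ hpS⟩
  · rintro ⟨p, hp, h⟩
    exact hV.ex_mono (fun S hS h => (hl S hS).2 (hS.mem_dnf.2 ⟨p, hp, h⟩)) h

theorem shriek (hφ : HasDnf φ) (x : ℕ) : HasDnf (QFO.shriek x φ) :=
  (hφ.snot.ex x).snot.congr fun V hV => by rw [hV.mem_shriek, hV.mem_neg]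

/-- By `preimage_all`, the normal form of φ can be evaluated in the model of formulas φ with ∀x φ in
V, so ∀x moves onto each classical entry. -/
theorem all (hφ : HasDnf φ) (x : ℕ) : HasDnf (QFO.all x φ) := by
  obtain ⟨l, hl⟩ := hφ
  refine of_exists l (fun p => TeamLogic.nf (.all x p.1) (p.2.map (Fm.all x)))
    (fun p _ => nf _ _) fun V hV => ?_
  have hW := hV.preimage_all x
  refine (hl _ hW).trans (hW.mem_dnf.trans (exists_congr fun p => and_congr_right fun _ => ?_))
  rw [hW.mem_nf, hV.mem_nf, List.forall_mem_map]
  rfl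

end HasDnf

theorem hasDnf {k : Kind} (φ : Fm L k) : HasDnf (⟨k, φ⟩ : QFO L) := by
  induction φ with
  | equal t u => exact .fo _
  | rel R ts => exact .fo _
  | neg α _ => exact .fo _
  | imp α β _ _ => exact .fo _
  | all x φ ih => exact ih.all x
  | snot φ ih => exact ih.snot
  | mimp φ ψ ih ih' => exact ih.mimp ih'
  | limp φ ψ ih ih' => exact ih.limp ih'
  | shriek x φ ih => exact ih.shriek x

/-! ### From models back to derivations -/

theorem isBFO_nf (α : FO L) (l : List (FO L)) : IsBFO (nf α l) := by
  induction l with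
  | nil => exact .fo α
  | cons β l ih => exact .snot (.mimp (.snot (.fo β)) (.snot ih))

theorem isBFO_dnf (l : List (FO L × List (FO L))) : IsBFO (dnf l) := by
  induction l with
  | nil => exact .snot (.mimp (.fo _) (.fo _))
  | cons p l ih => exact .mimp (.snot (isBFO_nf _ _)) ih

theorem provablyEquivalent_of_forall_model {φ ψ : QFO L}
    (h : ∀ V, IsModel V → (φ ∈ V ↔ ψ ∈ V)) : (HLSQ L).ProvablyEquivalent φ ψ := by
  have key : ∀ {φ ψ : QFO L}, (∀ V, IsModel V → φ ∈ V → ψ ∈ V) → (HLSQ L).Derives {φ} ψ :=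
    fun h => derives_mp (.prem rfl) ((provable_of_forall_model fun V hV =>
      hV.mem_imp.2 (h V hV) : Provable _).mono (Set.empty_subset _))
  exact ⟨key fun V hV => (h V hV).1, key fun V hV => (h V hV).2⟩

end TeamLogic

theorem mainTheorem6 (L : FirstOrder.Language) (φ : TeamLogic.QFO L) :
    ∃ ψ : TeamLogic.QFO L, TeamLogic.IsBFO ψ ∧
      (TeamLogic.HLSQ L).ProvablyEquivalent φ ψ := by
  obtain ⟨l, hl⟩ := TeamLogic.hasDnf φ.2
  exact ⟨TeamLogic.dnf l, TeamLogic.isBFO_dnf l,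
    TeamLogic.provablyEquivalent_of_forall_model hl⟩
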